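/- Let $0<\alpha<1$ and let $\omega:\mathbb{Z}\to(0,\infty)$. For $m\in\mathbb{Z}$ and $N\in\{0,1,2,\dots\}$ put $S_{m,N}=\{k\in\mathbb{Z}:|k-m|\le N\}$, so that $|S_{m,N}|=2N+1$. For $1<p<\infty$ let $p'=p/(p-1)$. For $1<p,q<\infty$ we say that $\omega\in\mathcal{A}(p,q)$ if $$\sup_{m\in\mathbb{Z},\,N\ge 0}\Big(\frac1{|S_{m,N}|}\sum_{k\in S_{m,N}}\omega(k)^q\Big)^{1/q}\Big(\frac1{|S_{m,N}|}\sum_{k\in S_{m,N}}\omega(k)^{-p'}\Big)^{1/p'}<\infty .$$ For $p=1$ and $1<q<\infty$ the second factor is replaced by $\sup_{k\in S_{m,N}}\frac1{\omega(k)}$, and for $1<p<\infty$ and $q=\infty$ the first factor is replaced by $\sup_{k\in S_{m,N}}\omega(k)$. Then the following hold. (iii) Let $1<p<\frac1\alpha$ and $\frac1q=\frac1p-\alpha$. If $\omega\in\mathcal{A}(p,q)$, then there exist real numbers $p_1,p_2,q_1,q_2$ such that $1<p_1<p<p_2<\frac1\alpha$, $\frac1{q_i}=\frac1{p_i}-\alpha$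 and $\omega\in\mathcal{A}(p_i,q_i)$ for $i=1,2$. (iv) Let $\frac1{q_0}=1-\alpha$. If $\omega\in\mathcal{A}(1,q_0)$, then there exist real numbers $p_1\in(1,\frac1\alpha)$ and $q_1\in(q_0,\infty)$ with $\frac1{q_1}=\frac1{p_1}-\alpha$ such that, for every $t\in[0,1]$, $\omega\in\mathcal{A}(p,q)$, where $\frac1p=t+\frac{1-t}{p_1}$ and $\frac1q=\frac t{q_0}+\frac{1-t}{q_1}$. (v) Let $p_0=\frac1\alpha$. If $\omega\in\mathcal{A}(p_0,\infty)$, then there exist real numbers $p_2\in(1,p_0)$ and $q_2\in(1,\infty)$ with $\frac1{q_2}=\frac1{p_2}-\alpha$ such that, for every $t\in[0,1]$, $\omega\in\mathcal{A}(p,q)$, where $\frac1p=\frac t{p_0}+\frac{1-t}{p_2}$ and $\frac1q=\frac{1-t}{q_2}$ (so $q=\infty$ when $t=1$). -/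

import Mathlib

open scoped ENNReal

noncomputable section

namespace DiscreteMuckenhoupt

/-- The symmetric interval `S_{m,N} = {k ∈ ℤ : |k - m| ≤ N}`. -/
def symInterval (m : ℤ) (N : ℕ) : Finset ℤ := Finset.Icc (m - N) (m + N)

theorem mem_symInterval {m k : ℤ} {N : ℕ} : k ∈ symInterval m N ↔ |k - m| ≤ (N : ℤ) := by
  rw [symInterval, Finset.mem_Icc, abs_le]
  constructor <;> rintro ⟨h1, h2⟩ <;> constructor <;> linarith

theorem card_symInterval (m : ℤ) (N : ℕ) : (symInterval m N).card = 2 * N + 1 := by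
  rw [symInterval, Int.card_Icc]
  omega

theorem symInterval_nonempty (m : ℤ) (N : ℕ) : (symInterval m N).Nonempty :=
  ⟨m, mem_symInterval.2 (by simp)⟩

/-- The arithmetic mean of `f` over `S_{m,N}`. -/
def avg (f : ℤ → ℝ) (m : ℤ) (N : ℕ) : ℝ :=
  1 / ((symInterval m N).card : ℝ) * ∑ k ∈ symInterval m N, f k

/-- The maximum (supremum) of `f` over the finite non-empty set `S_{m,N}`. -/
def supOn (f : ℤ → ℝ) (m : ℤ) (N : ℕ) : ℝ :=
  (symInterval m N).sup' (symInterval_nonempty m N) f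

/-- The first factor of the `𝒜(p,q)` quantity: `(avg ω^q)^{1/q}` for finite `q`,
and `sup ω` for `q = ∞`. -/
def qFactor (q : ℝ≥0∞) (ω : ℤ → ℝ) (m : ℤ) (N : ℕ) : ℝ :=
  if q = ∞ then supOn ω m N
  else (avg (fun k => ω k ^ q.toReal) m N) ^ (1 / q.toReal)

/-- The second factor of the `𝒜(p,q)` quantity: `(avg ω^{-p'})^{1/p'}` with `p' = p / (p - 1)`
for `p > 1`, and `sup (1 / ω)` for `p = 1`. -/
def pFactor (p : ℝ) (ω : ℤ → ℝ) (m : ℤ) (N : ℕ) : ℝ :=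
  if p = 1 then supOn (fun k => 1 / ω k) m N
  else (avg (fun k => ω k ^ (-(p / (p - 1)))) m N) ^ (1 / (p / (p - 1)))

/-- The `𝒜(p,q)(ℤ)` constant of `ω`, as an element of `[0,∞]`, for `1 ≤ p < ∞`, `1 < q ≤ ∞`. -/
def apqNorm (p : ℝ) (q : ℝ≥0∞) (ω : ℤ → ℝ) : ℝ≥0∞ :=
  ⨆ (m : ℤ) (N : ℕ), ENNReal.ofReal (qFactor q ω m N * pFactor p ω m N)

/-- The weight `ω : ℤ → (0,∞)` belongs to `𝒜(p,q)(ℤ)`, for `1 ≤ p < ∞`, `1 < q ≤ ∞`. -/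
def MemApq (p : ℝ) (q : ℝ≥0∞) (ω : ℤ → ℝ) : Prop :=
  (∀ k, 0 < ω k) ∧ apqNorm p q ω < ∞

end DiscreteMuckenhoupt

end

open scoped ENNReal

namespace DiscreteMuckenhoupt

/-! Membership in `𝒜(p,q)` says that the power means of `ω` of order `q` and of `ω⁻¹` of order `p'`
have bounded product (`memApq_iff_pairBounded`). Power means increase with the exponent, so this
property of a pair of exponents passes to smaller pairs (`PairBounded.mono`).

The core is that either finite exponent can be raised slightly (`PairBounded.exists_gt`). Hölder's
inequality makes `ω ^ s` an `A_∞` weight: a set filling half of an interval carries a fixed share of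
its mass. A stopping-time argument turns this into a reverse Hölder inequality
(`exists_reverse_holder`), which bounds a higher power mean by the original one.

Each claim is then arithmetic of exponents: the new pairs lie below an improved pair, so no
interpolation is needed. -/

/-! ### Intervals, stopping sets and the reverse Hölder inequality -/

theorem symInterval_eq_Ico (m : ℤ) (N : ℕ) :
    symInterval m N = Finset.Ico (m - N) (m - N + ((2 * N + 1 : ℕ) : ℤ)) := by
  ext k
  simp only [symInterval, Finset.mem_Icc, Finset.mem_Ico]
  push_cast
  omega

/-- Symmetric intervals have odd length, but bisection produces all lengths; this cover has at most
`n + 1` points. -/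
theorem Ico_subset_symInterval (a : ℤ) (n : ℕ) :
    Finset.Ico a (a + n) ⊆ symInterval (a + (n / 2 : ℕ)) (n / 2) := by
  intro k
  simp only [symInterval, Finset.mem_Icc, Finset.mem_Ico]
  omega

/-- A Calderón–Zygmund stopping set at height `lam`: if the mean of `w` over an interval is at most
`lam`, the stopping set `E` consists of intervals with mean between `lam` and `3 * lam`. -/
theorem exists_stopping_set {w G : ℤ → ℝ} (hw : ∀ k, 0 < w k) {lam D : ℝ} {n : ℕ}
    (H : ∀ (a : ℤ) (l : ℕ), 0 < l → l < n →
      ∑ k ∈ Finset.Ico a (a + l), w k ≤ 3 * lam * l →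
      ∑ k ∈ Finset.Ico a (a + l), G k ≤ D * ∑ k ∈ Finset.Ico a (a + l), w k)
    (l : ℕ) (hl : 0 < l) (hln : l ≤ n) (a : ℤ)
    (ha : ∑ k ∈ Finset.Ico a (a + l), w k ≤ lam * l) :
    ∃ E ⊆ Finset.Ico a (a + l), (∀ k ∈ Finset.Ico a (a + l), k ∉ E → w k ≤ lam) ∧
      lam * E.card ≤ ∑ k ∈ E, w k ∧ ∑ k ∈ E, G k ≤ D * ∑ k ∈ E, w k := by
  induction l using Nat.strong_induction_on generalizing a with
  | _ l ih =>
  -- On a single point the mean is the value itself, so nothing is selected.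
  obtain rfl | hl2 := Nat.eq_or_lt_of_le (Nat.succ_le_of_lt hl)
  · refine ⟨∅, by simp, ?_, by simp, by simp⟩
    intro k hk _
    have hk' : k = a := by
      simp only [Finset.mem_Ico] at hk
      push_cast at hk
      omega
    subst hk'
    have e : Finset.Ico k (k + (Nat.succ 0 : ℕ)) = {k} := by
      ext j
      simp only [Finset.mem_Ico, Finset.mem_singleton]
      push_cast
      omega
    rw [e] at ha
    simpa using ha
  have hlam : 0 ≤ lam := by
    have h0 : 0 ≤ lam * l := (Finset.sum_nonneg fun k _ => (hw k).le).trans ha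
    exact nonneg_of_mul_nonneg_left h0 (by exact_mod_cast hl)
  -- A half of mean at most `lam` is bisected further; otherwise it is selected whole. The factor 3
  -- is the worst ratio of parent to half, attained at `l = 3`.
  have half : ∀ (b : ℤ) (j : ℕ), 0 < j → j < l → l ≤ 3 * j →
      Finset.Ico b (b + j) ⊆ Finset.Ico a (a + l) →
      ∃ E ⊆ Finset.Ico b (b + j), (∀ k ∈ Finset.Ico b (b + j), k ∉ E → w k ≤ lam) ∧
        lam * E.card ≤ ∑ k ∈ E, w k ∧ ∑ k ∈ E, G k ≤ D * ∑ k ∈ E, w k := by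
    intro b j hj hjl hlj hsub
    by_cases hb : ∑ k ∈ Finset.Ico b (b + j), w k ≤ lam * j
    · exact ih j hjl hj (by omega) b hb
    · refine ⟨_, subset_rfl, fun k hk hk' => absurd hk hk', ?_, H b j hj (by omega) ?_⟩
      · have : (Finset.Ico b (b + j)).card = j := by simp
        rw [this]
        exact (not_le.1 hb).le
      · have h1 := Finset.sum_le_sum_of_subset_of_nonneg (f := w) hsub fun k _ _ => (hw k).le
        have h2 : (l : ℝ) ≤ 3 * j := by exact_mod_cast hlj
        nlinarith [mul_le_mul_of_nonneg_left h2 hlam]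
  obtain ⟨E₁, hs₁, hb₁, hc₁, hG₁⟩ := half a (l / 2) (by omega) (by omega) (by omega)
    (Finset.Ico_subset_Ico_right (by omega))
  obtain ⟨E₂, hs₂, hb₂, hc₂, hG₂⟩ := half (a + (l / 2 : ℕ)) (l - l / 2) (by omega) (by omega)
    (by omega) (Finset.Ico_subset_Ico (by omega) (by omega))
  have hdisj : Disjoint E₁ E₂ := by
    rw [Finset.disjoint_left]
    intro k h1 h2
    have h1 := Finset.mem_Ico.1 (hs₁ h1)
    have h2 := Finset.mem_Ico.1 (hs₂ h2)
    omega
  refine ⟨E₁ ∪ E₂, ?_, ?_, ?_, ?_⟩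
  · refine Finset.union_subset (hs₁.trans (Finset.Ico_subset_Ico_right (by omega)))
      (hs₂.trans (Finset.Ico_subset_Ico (by omega) (by omega)))
  · intro k hk hkE
    rw [Finset.mem_union, not_or] at hkE
    have hk := Finset.mem_Ico.1 hk
    by_cases h : k < a + (l / 2 : ℕ)
    · exact hb₁ k (Finset.mem_Ico.2 ⟨hk.1, h⟩) hkE.1
    · exact hb₂ k (Finset.mem_Ico.2 ⟨by omega, by omega⟩) hkE.2
  · rw [Finset.card_union_of_disjoint hdisj, Finset.sum_union hdisj]
    push_cast
    linarith
  · rw [Finset.sum_union hdisj, Finset.sum_union hdisj]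
    linarith

theorem exists_rpow_mul_lt_one {c β : ℝ} (hc : 0 < c) (hβ : β < 1) :
    ∃ ε : ℝ, 0 < ε ∧ c ^ ε * β < 1 := by
  have hcont : Continuous fun ε : ℝ => c ^ ε * β :=
    (Real.continuous_const_rpow hc.ne').mul continuous_const
  have h0 : ∀ᶠ ε in nhds (0 : ℝ), c ^ ε * β < 1 :=
    hcont.continuousAt.eventually_lt continuousAt_const (by simpa using hβ)
  obtain ⟨δ, hδ, h⟩ := Metric.eventually_nhds_iff.1 h0
  refine ⟨δ / 2, by positivity, h ?_⟩
  rw [Real.dist_eq, sub_zero, abs_of_pos (by positivity)]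
  linarith

/-- The reverse Hölder inequality for `A_∞` weights on intervals of `ℤ`. -/
theorem exists_reverse_holder {w : ℤ → ℝ} (hw : ∀ k, 0 < w k) {β : ℝ} (hβ : β < 1)
    (h : ∀ (a : ℤ) (n : ℕ), ∀ E ⊆ Finset.Ico a (a + n), 2 * E.card ≤ n →
      ∑ k ∈ E, w k ≤ β * ∑ k ∈ Finset.Ico a (a + n), w k) :
    ∃ ε : ℝ, 0 < ε ∧ ∃ C > 0, ∀ (a : ℤ) (n : ℕ), 0 < n →
      ∑ k ∈ Finset.Ico a (a + n), w k ^ (1 + ε) ≤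
        C * (∑ k ∈ Finset.Ico a (a + n), w k) * ((∑ k ∈ Finset.Ico a (a + n), w k) / n) ^ ε := by
  -- With `A` the mean, stopping at height `2A` gives intervals of mean at most `3 * 2A`, hence the
  -- 6.
  obtain ⟨ε, hε, hεβ⟩ := exists_rpow_mul_lt_one (c := 6) (by norm_num) hβ
  have hden : 0 < 1 - 6 ^ ε * β := by linarith
  -- `C` is the fixed point that closes the induction: `2 ^ ε` comes from off the stopping set, `C *
  -- 6 ^ ε * β` from on it.
  obtain ⟨C, hC⟩ : ∃ C, C = 2 ^ ε / (1 - 6 ^ ε * β) := ⟨_, rfl⟩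
  have hC0 : 0 < C := hC ▸ by positivity
  have hCeq : C * (6 ^ ε * β) + 2 ^ ε = C := by
    rw [hC]; field_simp; ring
  refine ⟨ε, hε, C, hC0, fun a n => ?_⟩
  induction n using Nat.strong_induction_on generalizing a with
  | _ n ih =>
  intro hn
  have hn' : (0 : ℝ) < n := by exact_mod_cast hn
  obtain ⟨W, hW⟩ : ∃ W, W = ∑ k ∈ Finset.Ico a (a + n), w k := ⟨_, rfl⟩
  have hW0 : 0 < W := hW ▸ Finset.sum_pos (fun k _ => hw k) (by simpa using hn)
  have hA0 : 0 < W / n := by positivity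
  obtain ⟨E, hE, hEle, hEc, hEG⟩ := exists_stopping_set (G := fun k => w k ^ (1 + ε)) hw
    (lam := 2 * (W / n)) (D := C * (6 * (W / n)) ^ ε) (n := n)
    (by
      intro b l hl hln hbl
      have hl' : (0 : ℝ) < l := by exact_mod_cast hl
      have hs : 0 ≤ ∑ k ∈ Finset.Ico b (b + l), w k := Finset.sum_nonneg fun k _ => (hw k).le
      refine (ih l hln b hl).trans ?_
      have : ((∑ k ∈ Finset.Ico b (b + l), w k) / l) ^ ε ≤ (6 * (W / n)) ^ ε := by
        refine Real.rpow_le_rpow (by positivity) ?_ hε.le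
        rw [div_le_iff₀ hl']
        linarith
      calc _ ≤ C * (∑ k ∈ Finset.Ico b (b + l), w k) * (6 * (W / n)) ^ ε := by gcongr
        _ = _ := by ring)
    n hn le_rfl a (by
      rw [← hW]
      have : 2 * (W / n) * n = 2 * W := by field_simp
      linarith)
  have hEW : ∑ k ∈ E, w k ≤ W :=
    hW ▸ Finset.sum_le_sum_of_subset_of_nonneg hE fun k _ _ => (hw k).le
  -- Chebyshev: `w` averages at least twice its overall mean on `E`, so `E` fills at most half of
  -- the interval and `h` applies.
  have hcard : 2 * E.card ≤ n := by
    have h1 : 2 * (W / n) * E.card ≤ W := hEc.trans hEW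
    have h2 : W * (2 * E.card) ≤ W * n := by
      have : 2 * (W / n) * E.card = W * (2 * E.card) / n := by ring
      rw [this, div_le_iff₀ hn'] at h1
      exact h1
    exact_mod_cast le_of_mul_le_mul_left h2 hW0
  have hEβ : ∑ k ∈ E, w k ≤ β * W := hW ▸ h a n E hE hcard
  have hoff : ∑ k ∈ Finset.Ico a (a + n) \ E, w k ^ (1 + ε) ≤ (2 * (W / n)) ^ ε * W := by
    calc ∑ k ∈ Finset.Ico a (a + n) \ E, w k ^ (1 + ε)
        ≤ ∑ k ∈ Finset.Ico a (a + n) \ E, (2 * (W / n)) ^ ε * w k := by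
          refine Finset.sum_le_sum fun k hk => ?_
          rw [Finset.mem_sdiff] at hk
          rw [Real.rpow_add (hw k), Real.rpow_one, mul_comm]
          exact mul_le_mul_of_nonneg_right
            (Real.rpow_le_rpow (hw k).le (hEle k hk.1 hk.2) hε.le) (hw k).le
      _ = (2 * (W / n)) ^ ε * ∑ k ∈ Finset.Ico a (a + n) \ E, w k := by rw [Finset.mul_sum]
      _ ≤ (2 * (W / n)) ^ ε * W := by
          refine mul_le_mul_of_nonneg_left ?_ (by positivity)
          exact hW ▸ Finset.sum_le_sum_of_subset_of_nonneg Finset.sdiff_subset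
            fun k _ _ => (hw k).le
  rw [← Finset.sum_sdiff hE, ← hW]
  have hon : ∑ k ∈ E, w k ^ (1 + ε) ≤ C * (6 * (W / n)) ^ ε * (β * W) :=
    hEG.trans (mul_le_mul_of_nonneg_left hEβ (by positivity))
  rw [Real.mul_rpow (by norm_num) hA0.le] at hoff hon
  calc _ ≤ 2 ^ ε * (W / n) ^ ε * W + C * (6 ^ ε * (W / n) ^ ε) * (β * W) := add_le_add hoff hon
    _ = (C * (6 ^ ε * β) + 2 ^ ε) * W * (W / n) ^ ε := by ring
    _ = _ := by rw [hCeq]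

/-! ### Power means -/

theorem avg_pos {f : ℤ → ℝ} (hf : ∀ k, 0 < f k) (m : ℤ) (N : ℕ) : 0 < avg f m N :=
  mul_pos (one_div_pos.2 (by exact_mod_cast (symInterval_nonempty m N).card_pos))
    (Finset.sum_pos (fun k _ => hf k) (symInterval_nonempty m N))

theorem supOn_pos {f : ℤ → ℝ} (hf : ∀ k, 0 < f k) (m : ℤ) (N : ℕ) : 0 < supOn f m N :=
  (hf m).trans_le (Finset.le_sup' f (mem_symInterval.2 (by simp)))

theorem qFactor_pos {ω : ℤ → ℝ} (hω : ∀ k, 0 < ω k) (s : ℝ≥0∞) (m : ℤ) (N : ℕ) :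
    0 < qFactor s ω m N := by
  unfold qFactor
  split_ifs
  · exact supOn_pos hω m N
  · exact Real.rpow_pos_of_pos (avg_pos (fun k => Real.rpow_pos_of_pos (hω k) _) m N) _

theorem avg_rpow_le {f : ℤ → ℝ} (hf : ∀ k, 0 ≤ f k) {r : ℝ} (hr : 1 ≤ r) (m : ℤ) (N : ℕ) :
    avg f m N ^ r ≤ avg (fun k => f k ^ r) m N := by
  unfold avg
  rw [Finset.mul_sum, Finset.mul_sum]
  refine Real.rpow_arith_mean_le_arith_mean_rpow _ _ _ (fun _ _ => by positivity) ?_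
    (fun k _ => hf k) hr
  rw [Finset.sum_const, nsmul_eq_mul]
  have : ((symInterval m N).card : ℝ) ≠ 0 := by
    exact_mod_cast (symInterval_nonempty m N).card_pos.ne'
  field_simp

theorem avg_le_of_forall_le {f : ℤ → ℝ} {m : ℤ} {N : ℕ} {c : ℝ}
    (h : ∀ k ∈ symInterval m N, f k ≤ c) : avg f m N ≤ c := by
  have hc : (0 : ℝ) < (symInterval m N).card := by
    exact_mod_cast (symInterval_nonempty m N).card_pos
  have := Finset.sum_le_card_nsmul _ _ _ h
  rw [nsmul_eq_mul] at this
  unfold avg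
  rw [one_div_mul_eq_div, div_le_iff₀ hc]
  linarith

/-- Power means increase with the exponent. -/
theorem qFactor_mono {ω : ℤ → ℝ} (hω : ∀ k, 0 < ω k) {s s' : ℝ≥0∞} (hs : s ≠ 0) (hss : s ≤ s')
    (m : ℤ) (N : ℕ) : qFactor s ω m N ≤ qFactor s' ω m N := by
  by_cases h : s = ∞
  · obtain rfl : s' = ∞ := top_le_iff.1 (h ▸ hss)
    rw [h]
  have hs0 : 0 < s.toReal := ENNReal.toReal_pos hs h
  have hpos : ∀ k, 0 < ω k ^ s.toReal := fun k => Real.rpow_pos_of_pos (hω k) _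
  by_cases h' : s' = ∞
  · rw [qFactor, qFactor, if_neg h, if_pos h']
    rw [one_div, Real.rpow_inv_le_iff_of_pos (avg_pos hpos m N).le (supOn_pos hω m N).le hs0]
    exact avg_le_of_forall_le fun k hk =>
      Real.rpow_le_rpow (hω k).le (Finset.le_sup' ω hk) hs0.le
  · have hs'0 : s.toReal ≤ s'.toReal := ENNReal.toReal_mono h' hss
    have hs' : 0 < s'.toReal := hs0.trans_le hs'0
    rw [qFactor, qFactor, if_neg h, if_neg h']
    have key := avg_rpow_le (fun k => (hpos k).le) ((one_le_div hs0).2 hs'0) m N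
    have hfun : (fun k => (ω k ^ s.toReal) ^ (s'.toReal / s.toReal)) =
        fun k => ω k ^ s'.toReal := by
      funext k
      rw [← Real.rpow_mul (hω k).le, mul_div_cancel₀ _ hs0.ne']
    rw [hfun] at key
    have := Real.rpow_le_rpow (Real.rpow_nonneg (avg_pos hpos m N).le _) key
      (one_div_pos.2 hs').le
    rwa [← Real.rpow_mul (avg_pos hpos m N).le,
      show s'.toReal / s.toReal * (1 / s'.toReal) = 1 / s.toReal by field_simp] at this

/-! ### The two-exponent condition and its self-improvement -/

/-- The power means of `ω` of order `s` and of `ω⁻¹` of order `t` have bounded product. -/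
def PairBounded (s t : ℝ≥0∞) (ω : ℤ → ℝ) : Prop :=
  ∃ C : ℝ, ∀ (m : ℤ) (N : ℕ), qFactor s ω m N * qFactor t ω⁻¹ m N ≤ C

/-- This duality lets one improvement result serve both factors. -/
theorem PairBounded.symm {s t : ℝ≥0∞} {ω : ℤ → ℝ} (h : PairBounded s t ω) :
    PairBounded t s ω⁻¹ := by
  obtain ⟨C, hC⟩ := h
  exact ⟨C, fun m N => by rw [inv_inv, mul_comm]; exact hC m N⟩

theorem PairBounded.mono {s s' t t' : ℝ≥0∞} {ω : ℤ → ℝ} (hω : ∀ k, 0 < ω k)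
    (h : PairBounded s' t' ω) (hs : s ≠ 0) (hss : s ≤ s') (ht : t ≠ 0) (htt : t ≤ t') :
    PairBounded s t ω := by
  obtain ⟨C, hC⟩ := h
  have hω' : ∀ k, 0 < ω⁻¹ k := fun k => inv_pos.2 (hω k)
  exact ⟨C, fun m N => (mul_le_mul (qFactor_mono hω hs hss m N) (qFactor_mono hω' ht htt m N)
    (qFactor_pos hω' t m N).le (qFactor_pos hω s' m N).le).trans (hC m N)⟩

/-- Hölder's inequality for `1 = ω * ω⁻¹`. -/
theorem card_rpow_le {ω : ℤ → ℝ} (hω : ∀ k, 0 < ω k) {s t : ℝ} (hs : 0 < s) (ht : 0 < t)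
    (F : Finset ℤ) :
    (F.card : ℝ) ^ (1 / s + 1 / t) ≤
      (∑ k ∈ F, ω k ^ s) ^ (1 / s) * (∑ k ∈ F, ω⁻¹ k ^ t) ^ (1 / t) := by
  -- Since `1 / u = 1 / s + 1 / t`, the exponents `s / u` and `t / u` are conjugate.
  obtain ⟨u, hu⟩ : ∃ u, u = s * t / (s + t) := ⟨_, rfl⟩
  have hu0 : 0 < u := hu ▸ by positivity
  have hconj : (s / u).HolderConjugate (t / u) := by
    rw [Real.holderConjugate_iff]
    constructor
    · rw [hu, lt_div_iff₀ (by positivity), one_mul, div_lt_iff₀ (by positivity)]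
      nlinarith
    · rw [hu]; field_simp; ring
  have hω' : ∀ k, 0 < ω⁻¹ k := fun k => inv_pos.2 (hω k)
  have hsum1 : 0 ≤ ∑ k ∈ F, ω k ^ s := Finset.sum_nonneg fun k _ => Real.rpow_nonneg (hω k).le _
  have hsum2 : 0 ≤ ∑ k ∈ F, ω⁻¹ k ^ t :=
    Finset.sum_nonneg fun k _ => Real.rpow_nonneg (hω' k).le _
  have key := Real.inner_le_Lp_mul_Lq_of_nonneg F hconj
    (f := fun k => ω k ^ u) (g := fun k => ω⁻¹ k ^ u)
    (fun k _ => Real.rpow_nonneg (hω k).le _) (fun k _ => Real.rpow_nonneg (hω' k).le _)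
  have e1 : ∀ k, ω k ^ u * ω⁻¹ k ^ u = 1 := fun k => by
    rw [← Real.mul_rpow (hω k).le (hω' k).le, Pi.inv_apply, mul_inv_cancel₀ (hω k).ne',
      Real.one_rpow]
  have e2 : ∀ k, (ω k ^ u) ^ (s / u) = ω k ^ s := fun k => by
    rw [← Real.rpow_mul (hω k).le, mul_div_cancel₀ _ hu0.ne']
  have e3 : ∀ k, (ω⁻¹ k ^ u) ^ (t / u) = ω⁻¹ k ^ t := fun k => by
    rw [← Real.rpow_mul (hω' k).le, mul_div_cancel₀ _ hu0.ne']
  simp only [e1, e2, e3, Finset.sum_const, nsmul_eq_mul, mul_one] at key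
  have := Real.rpow_le_rpow (by positivity) key (one_div_pos.2 hu0).le
  rw [Real.mul_rpow (by positivity) (by positivity), ← Real.rpow_mul hsum1,
    ← Real.rpow_mul hsum2] at this
  rwa [show 1 / (s / u) * (1 / u) = 1 / s by field_simp,
    show 1 / (t / u) * (1 / u) = 1 / t by field_simp,
    show 1 / u = 1 / s + 1 / t by rw [hu]; field_simp; ring] at this

/-- The `A_∞` property of `ω ^ s` on sets filling half of an interval. -/
theorem PairBounded.exists_sum_le {s t : ℝ} (hs : 0 < s) (ht : 0 < t) {ω : ℤ → ℝ}
    (hω : ∀ k, 0 < ω k) (h : PairBounded (ENNReal.ofReal s) (ENNReal.ofReal t) ω) :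
    ∃ K > 0, ∀ (a : ℤ) (n : ℕ), ∀ F ⊆ Finset.Ico a (a + n), n ≤ 2 * F.card →
      ∑ k ∈ Finset.Ico a (a + n), ω k ^ s ≤ K * ∑ k ∈ F, ω k ^ s := by
  obtain ⟨C, hC⟩ := h
  have hω' : ∀ k, 0 < ω⁻¹ k := fun k => inv_pos.2 (hω k)
  have hC0 : 0 < C :=
    (mul_pos (qFactor_pos hω _ 0 0) (qFactor_pos hω' _ 0 0)).trans_le (hC 0 0)
  refine ⟨(C * 4 ^ (1 / s + 1 / t)) ^ s, by positivity, fun a n F hF hn => ?_⟩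
  obtain rfl | hn0 := Nat.eq_zero_or_pos n
  · simp only [Nat.cast_zero, add_zero, Finset.Ico_self, Finset.sum_empty]
    exact mul_nonneg (by positivity)
      (Finset.sum_nonneg fun k _ => Real.rpow_nonneg (hω k).le _)
  obtain ⟨S, hS⟩ : ∃ S, S = symInterval (a + (n / 2 : ℕ)) (n / 2) := ⟨_, rfl⟩
  have hIS : Finset.Ico a (a + n) ⊆ S := hS ▸ Ico_subset_symInterval a n
  have hcard : S.card ≤ 4 * F.card := by
    rw [hS, card_symInterval]
    omega
  have hF0 : (0 : ℝ) < F.card := by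
    have : 0 < F.card := by omega
    exact_mod_cast this
  have hS0 : (0 : ℝ) < S.card := by
    exact_mod_cast Nat.lt_of_lt_of_le (by exact_mod_cast hF0) (Finset.card_le_card (hF.trans hIS))
  have hbound := hC (a + (n / 2 : ℕ)) (n / 2)
  simp only [qFactor, ENNReal.ofReal_ne_top, if_false, ENNReal.toReal_ofReal hs.le,
    ENNReal.toReal_ofReal ht.le, avg, ← hS] at hbound
  have p1 : ∀ T : Finset ℤ, 0 ≤ ∑ k ∈ T, ω k ^ s := fun T =>
    Finset.sum_nonneg fun k _ => Real.rpow_nonneg (hω k).le _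
  have p2 : ∀ T : Finset ℤ, 0 ≤ ∑ k ∈ T, ω⁻¹ k ^ t := fun T =>
    Finset.sum_nonneg fun k _ => Real.rpow_nonneg (hω' k).le _
  have hST : (∑ k ∈ S, ω k ^ s) ^ (1 / s) * (∑ k ∈ S, ω⁻¹ k ^ t) ^ (1 / t) ≤
      C * (S.card : ℝ) ^ (1 / s + 1 / t) := by
    rw [Real.mul_rpow (by positivity) (p1 S), Real.mul_rpow (by positivity) (p2 S),
      one_div (S.card : ℝ), Real.inv_rpow hS0.le, Real.inv_rpow hS0.le] at hbound
    rw [Real.rpow_add hS0]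
    have q1 := Real.rpow_pos_of_pos hS0 (1 / s)
    have q2 := Real.rpow_pos_of_pos hS0 (1 / t)
    have e : ((S.card : ℝ) ^ (1 / s))⁻¹ * (∑ k ∈ S, ω k ^ s) ^ (1 / s) *
        (((S.card : ℝ) ^ (1 / t))⁻¹ * (∑ k ∈ S, ω⁻¹ k ^ t) ^ (1 / t)) =
        (∑ k ∈ S, ω k ^ s) ^ (1 / s) * (∑ k ∈ S, ω⁻¹ k ^ t) ^ (1 / t) /
          ((S.card : ℝ) ^ (1 / s) * (S.card : ℝ) ^ (1 / t)) := by
      field_simp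
    rwa [e, div_le_iff₀ (by positivity)] at hbound
  have hFh := card_rpow_le hω hs ht F
  have hFS : (∑ k ∈ F, ω⁻¹ k ^ t) ^ (1 / t) ≤ (∑ k ∈ S, ω⁻¹ k ^ t) ^ (1 / t) :=
    Real.rpow_le_rpow (p2 F) (Finset.sum_le_sum_of_subset_of_nonneg (hF.trans hIS)
      fun k _ _ => Real.rpow_nonneg (hω' k).le _) (by positivity)
  have hScard : (S.card : ℝ) ^ (1 / s + 1 / t) ≤
      4 ^ (1 / s + 1 / t) * (F.card : ℝ) ^ (1 / s + 1 / t) := by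
    rw [← Real.mul_rpow (by norm_num) hF0.le]
    exact Real.rpow_le_rpow hS0.le (by exact_mod_cast hcard) (by positivity)
  have hf := Real.rpow_pos_of_pos hF0 (1 / s + 1 / t)
  -- The sum of `ω⁻¹ ^ t` over `S` cancels between Hölder's lower bound on `F` and the upper bound
  -- on `S`.
  have hroot : (∑ k ∈ S, ω k ^ s) ^ (1 / s) ≤
      C * 4 ^ (1 / s + 1 / t) * (∑ k ∈ F, ω k ^ s) ^ (1 / s) := by
    refine le_of_mul_le_mul_right ?_ hf
    have n1 := Real.rpow_nonneg (p1 S) (1 / s)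
    have n2 := Real.rpow_nonneg (p1 F) (1 / s)
    calc (∑ k ∈ S, ω k ^ s) ^ (1 / s) * (F.card : ℝ) ^ (1 / s + 1 / t)
        ≤ (∑ k ∈ S, ω k ^ s) ^ (1 / s) *
          ((∑ k ∈ F, ω k ^ s) ^ (1 / s) * (∑ k ∈ S, ω⁻¹ k ^ t) ^ (1 / t)) := by
          gcongr
          exact hFh.trans (by gcongr)
      _ = (∑ k ∈ F, ω k ^ s) ^ (1 / s) *
          ((∑ k ∈ S, ω k ^ s) ^ (1 / s) * (∑ k ∈ S, ω⁻¹ k ^ t) ^ (1 / t)) := by ring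
      _ ≤ (∑ k ∈ F, ω k ^ s) ^ (1 / s) *
          (C * (4 ^ (1 / s + 1 / t) * (F.card : ℝ) ^ (1 / s + 1 / t))) := by
          exact mul_le_mul_of_nonneg_left (hST.trans (by gcongr)) n2
      _ = _ := by ring
  calc ∑ k ∈ Finset.Ico a (a + n), ω k ^ s ≤ ∑ k ∈ S, ω k ^ s :=
        Finset.sum_le_sum_of_subset_of_nonneg hIS fun k _ _ => Real.rpow_nonneg (hω k).le _
    _ = ((∑ k ∈ S, ω k ^ s) ^ (1 / s)) ^ s := by
        rw [← Real.rpow_mul (p1 S), one_div_mul_cancel hs.ne', Real.rpow_one]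
    _ ≤ (C * 4 ^ (1 / s + 1 / t) * (∑ k ∈ F, ω k ^ s) ^ (1 / s)) ^ s :=
        Real.rpow_le_rpow (Real.rpow_nonneg (p1 S) _) hroot hs.le
    _ = _ := by
        rw [Real.mul_rpow (by positivity) (Real.rpow_nonneg (p1 F) _), ← Real.rpow_mul (p1 F),
          one_div_mul_cancel hs.ne', Real.rpow_one]

/-- The exponent of the first factor can be increased. -/
theorem PairBounded.exists_gt {s : ℝ} {t : ℝ≥0∞} (hs : 0 < s) (ht : t ≠ 0) {ω : ℤ → ℝ}
    (hω : ∀ k, 0 < ω k) (h : PairBounded (ENNReal.ofReal s) t ω) :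
    ∃ s' > s, PairBounded (ENNReal.ofReal s') t ω := by
  -- The `A_∞` property needs only some finite second exponent; the conclusion keeps `t`, possibly
  -- infinite.
  obtain ⟨t₀, ht₀, ht₀t⟩ : ∃ t₀ : ℝ, 0 < t₀ ∧ ENNReal.ofReal t₀ ≤ t := by
    by_cases htop : t = ∞
    · exact ⟨1, one_pos, htop ▸ le_top⟩
    · exact ⟨t.toReal, ENNReal.toReal_pos ht htop, (ENNReal.ofReal_toReal htop).le⟩
  have hs' : ENNReal.ofReal s ≠ 0 := (ENNReal.ofReal_pos.2 hs).ne'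
  obtain ⟨K, hK0, hK⟩ :=
    (h.mono hω hs' le_rfl (ENNReal.ofReal_pos.2 ht₀).ne' ht₀t).exists_sum_le hs ht₀ hω
  have hw : ∀ k, 0 < ω k ^ s := fun k => Real.rpow_pos_of_pos (hω k) _
  obtain ⟨ε, hε, D, hD, hRH⟩ := exists_reverse_holder (w := fun k => ω k ^ s) hw
    (β := 1 - K⁻¹) (by linarith [inv_pos.2 hK0]) (by
      intro a n E hE hn
      -- The complement of `E` fills at least half, so it carries at least `K⁻¹` of the mass.
      have hc : (Finset.Ico a (a + n) \ E).card = n - E.card := by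
        rw [Finset.card_sdiff_of_subset hE]
        simp
      have := hK a n (Finset.Ico a (a + n) \ E) Finset.sdiff_subset (by omega)
      rw [← Finset.sum_sdiff hE] at this ⊢
      have h2 := mul_le_mul_of_nonneg_left this (inv_pos.2 hK0).le
      rw [← mul_assoc, inv_mul_cancel₀ hK0.ne', one_mul] at h2
      linarith)
  obtain ⟨C, hC⟩ := h
  have hs1 : 0 < s * (1 + ε) := by positivity
  have hfactor : ∀ m N, qFactor (ENNReal.ofReal (s * (1 + ε))) ω m N ≤
      D ^ (1 / (s * (1 + ε))) * qFactor (ENNReal.ofReal s) ω m N := by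
    intro m N
    simp only [qFactor, ENNReal.ofReal_ne_top, if_false, ENNReal.toReal_ofReal hs.le,
      ENNReal.toReal_ofReal hs1.le]
    have hA := avg_pos hw m N
    have key : avg (fun k => ω k ^ (s * (1 + ε))) m N ≤
        D * avg (fun k => ω k ^ s) m N ^ (1 + ε) := by
      have := hRH (m - N) (2 * N + 1) (by omega)
      rw [← symInterval_eq_Ico, ← card_symInterval m N] at this
      have hc : (0 : ℝ) < (symInterval m N).card := by
        exact_mod_cast (symInterval_nonempty m N).card_pos
      have e : ∀ k, (ω k ^ s) ^ (1 + ε) = ω k ^ (s * (1 + ε)) := fun k =>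
        (Real.rpow_mul (hω k).le _ _).symm
      simp only [e] at this
      rw [Real.rpow_add hA, Real.rpow_one]
      have e' : avg (fun k => ω k ^ s) m N =
          (∑ k ∈ symInterval m N, ω k ^ s) / (symInterval m N).card := one_div_mul_eq_div _ _
      rw [← e'] at this
      calc avg (fun k => ω k ^ (s * (1 + ε))) m N
          ≤ 1 / ((symInterval m N).card : ℝ) * (D * (∑ k ∈ symInterval m N, ω k ^ s) *
            avg (fun k => ω k ^ s) m N ^ ε) := mul_le_mul_of_nonneg_left this (by positivity)
        _ = D * ((∑ k ∈ symInterval m N, ω k ^ s) / (symInterval m N).card *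
            avg (fun k => ω k ^ s) m N ^ ε) := by ring
        _ = _ := by rw [← e']
    have := Real.rpow_le_rpow (avg_pos (fun k => Real.rpow_pos_of_pos (hω k) _) m N).le key
      (one_div_pos.2 hs1).le
    rwa [Real.mul_rpow hD.le (by positivity), ← Real.rpow_mul hA.le,
      show (1 + ε) * (1 / (s * (1 + ε))) = 1 / s by field_simp] at this
  refine ⟨s * (1 + ε), by nlinarith, D ^ (1 / (s * (1 + ε))) * C, fun m N => ?_⟩
  have hω' : ∀ k, 0 < ω⁻¹ k := fun k => inv_pos.2 (hω k)
  calc _ ≤ D ^ (1 / (s * (1 + ε))) * qFactor (ENNReal.ofReal s) ω m N * qFactor t ω⁻¹ m N :=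
        mul_le_mul_of_nonneg_right (hfactor m N) (qFactor_pos hω' t m N).le
    _ = D ^ (1 / (s * (1 + ε))) * (qFactor (ENNReal.ofReal s) ω m N * qFactor t ω⁻¹ m N) := by ring
    _ ≤ _ := mul_le_mul_of_nonneg_left (hC m N) (by positivity)

/-! ### Conjugate exponents and translation of `𝒜(p,q)` -/

/-- The exponent conjugate to `p`, equal to `∞` for `p = 1`. -/
noncomputable def conjExponent (p : ℝ) : ℝ≥0∞ := if p = 1 then ∞ else ENNReal.ofReal (p / (p - 1))

theorem conjExponent_of_one_lt {p : ℝ} (hp : 1 < p) :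
    conjExponent p = ENNReal.ofReal (p / (p - 1)) := if_neg hp.ne'

theorem conjExponent_ne_zero {p : ℝ} (hp : 1 ≤ p) : conjExponent p ≠ 0 := by
  unfold conjExponent
  split_ifs with h
  · simp
  · have : 0 < p - 1 := sub_pos.2 (lt_of_le_of_ne hp (Ne.symm h))
    exact (ENNReal.ofReal_pos.2 (by positivity)).ne'

theorem conjExponent_le {p t : ℝ} (hp : 1 < p) (ht : 0 < t) (h : 1 / t ≤ 1 - 1 / p) :
    conjExponent p ≤ ENNReal.ofReal t := by
  rw [conjExponent_of_one_lt hp]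
  have hp' : 0 < p - 1 := by linarith
  refine ENNReal.ofReal_le_ofReal ?_
  have h2 : 1 - 1 / p = (p - 1) / p := by field_simp
  rw [h2, div_le_div_iff₀ ht (by linarith)] at h
  rw [div_le_iff₀ hp']
  linarith

theorem pFactor_eq_qFactor {p : ℝ} (hp : 1 ≤ p) {ω : ℤ → ℝ} (hω : ∀ k, 0 < ω k) (m : ℤ) (N : ℕ) :
    pFactor p ω m N = qFactor (conjExponent p) ω⁻¹ m N := by
  unfold pFactor conjExponent
  split_ifs with h
  · simp only [qFactor, if_true, one_div]
    rfl
  · have : 0 < p - 1 := sub_pos.2 (lt_of_le_of_ne hp (Ne.symm h))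
    simp only [qFactor, ENNReal.ofReal_ne_top, if_false,
      ENNReal.toReal_ofReal (show 0 ≤ p / (p - 1) by positivity), Pi.inv_apply]
    congr 2
    funext k
    rw [Real.rpow_neg (hω k).le, Real.inv_rpow (hω k).le]

theorem memApq_iff_pairBounded {p : ℝ} (hp : 1 ≤ p) {q : ℝ≥0∞} {ω : ℤ → ℝ} (hω : ∀ k, 0 < ω k) :
    MemApq p q ω ↔ PairBounded q (conjExponent p) ω := by
  unfold MemApq PairBounded apqNorm
  simp only [pFactor_eq_qFactor hp hω]
  constructor
  · rintro ⟨-, h⟩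
    refine ⟨_, fun m N => (ENNReal.ofReal_le_iff_le_toReal h.ne).1 ?_⟩
    exact le_iSup₂ (f := fun (m : ℤ) (N : ℕ) =>
      ENNReal.ofReal (qFactor q ω m N * qFactor (conjExponent p) ω⁻¹ m N)) m N
  · rintro ⟨C, hC⟩
    exact ⟨hω, (iSup₂_le fun m N => ENNReal.ofReal_le_ofReal (hC m N)).trans_lt
      ENNReal.ofReal_lt_top⟩

end DiscreteMuckenhoupt

/-! ### Interior and endpoint exponents -/

open DiscreteMuckenhoupt in
theorem memApq_self_improve_interior (α : ℝ) (ω : ℤ → ℝ) (hω : ∀ k, 0 < ω k)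
    (p q : ℝ) (hp : 1 < p) (hpα : p < 1 / α) (hα0 : 0 < α) (hq : 1 / q = 1 / p - α)
    (h : MemApq p (ENNReal.ofReal q) ω) :
    ∃ p₁ p₂ q₁ q₂ : ℝ, 1 < p₁ ∧ p₁ < p ∧ p < p₂ ∧ p₂ < 1 / α ∧
      1 / q₁ = 1 / p₁ - α ∧ 1 / q₂ = 1 / p₂ - α ∧
      MemApq p₁ (ENNReal.ofReal q₁) ω ∧ MemApq p₂ (ENNReal.ofReal q₂) ω := by
  have hp0 : 0 < p := by linarith
  have hq0 : 0 < q := by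
    rw [← one_div_pos, hq, sub_pos]
    exact (lt_one_div hp0 hα0).1 hpα
  have hω' : ∀ k, 0 < ω⁻¹ k := fun k => inv_pos.2 (hω k)
  have hp1 : 0 < p - 1 := by linarith
  rw [memApq_iff_pairBounded hp.le hω] at h
  obtain ⟨s, hsq, hs⟩ := h.exists_gt hq0 (conjExponent_ne_zero hp.le) hω
  have hs0 : 0 < s := hq0.trans hsq
  rw [conjExponent_of_one_lt hp] at hs
  -- The second exponent is raised with the improved `s` already in place.
  obtain ⟨t, htp, ht⟩ := hs.symm.exists_gt (by positivity) (ENNReal.ofReal_pos.2 hs0).ne' hω'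
  have ht := ht.symm
  rw [inv_inv] at ht
  have ht0 : 0 < t := lt_trans (by positivity) htp
  have htp' : 1 / t < 1 - 1 / p := by
    have := one_div_lt_one_div_of_lt (by positivity) htp
    rwa [one_div_div, show (p - 1) / p = 1 - 1 / p by field_simp] at this
  have hsq' : 1 / s < 1 / p - α := hq ▸ one_div_lt_one_div_of_lt hq0 hsq
  have ht1 : 0 < 1 / t := by positivity
  have hs1 : 0 < 1 / s := by positivity
  have hpi : 0 < 1 / p := by positivity
  -- In terms of `x = 1 / p`, the pair `(s, t)` covers `1 / s + α ≤ x ≤ 1 - 1 / t`, which has the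
  -- original `1 / p` in its interior.
  have mem : ∀ x : ℝ, x < 1 → 1 / t ≤ 1 - x → 1 / s ≤ x - α →
      MemApq (1 / x) (ENNReal.ofReal (1 / (x - α))) ω := by
    intro x hx1 hxt hxs
    have hxα : 0 < x - α := hs1.trans_le hxs
    have hx0 : 0 < x := by linarith
    have h1 : 1 < 1 / x := (one_lt_div hx0).2 hx1
    rw [memApq_iff_pairBounded h1.le hω]
    refine ht.mono hω (ENNReal.ofReal_pos.2 (by positivity)).ne' (ENNReal.ofReal_le_ofReal ?_)
      (conjExponent_ne_zero h1.le) (conjExponent_le h1 ht0 (by rwa [one_div_one_div]))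
    exact (one_div_le hs0 hxα).1 hxs
  obtain ⟨x, hx1, hx2⟩ := exists_between (show 1 / p < 1 - 1 / t by linarith)
  obtain ⟨y, hy1, hy2⟩ := exists_between (show 1 / s + α < 1 / p by linarith)
  have hp1' : 1 / p < 1 := by linarith
  refine ⟨1 / x, 1 / y, 1 / (x - α), 1 / (y - α), ?_, ?_, ?_, ?_, by simp, by simp,
    mem x (by linarith) (by linarith) (by linarith),
    mem y (by linarith) (by linarith) (by linarith)⟩
  · exact (one_lt_div (by linarith)).2 (by linarith)
  · exact (one_div_lt hp0 (by linarith)).1 hx1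
  · exact (lt_one_div (by linarith) hp0).1 hy2
  · exact one_div_lt_one_div_of_lt hα0 (by linarith)

open DiscreteMuckenhoupt in
theorem memApq_self_improve_left (α : ℝ) (hα0 : 0 < α) (hα1 : α < 1) (ω : ℤ → ℝ)
    (hω : ∀ k, 0 < ω k) (q₀ : ℝ) (hq₀ : 1 / q₀ = 1 - α) (h : MemApq 1 (ENNReal.ofReal q₀) ω) :
    ∃ p₁ q₁ : ℝ, 1 < p₁ ∧ p₁ < 1 / α ∧ q₀ < q₁ ∧ 1 / q₁ = 1 / p₁ - α ∧
      ∀ t ∈ Set.Icc (0 : ℝ) 1, ∀ p q : ℝ,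
        1 / p = t + (1 - t) / p₁ → 1 / q = t / q₀ + (1 - t) / q₁ →
        MemApq p (ENNReal.ofReal q) ω := by
  have hq0 : 0 < q₀ := by
    rw [← one_div_pos, hq₀]
    linarith
  rw [memApq_iff_pairBounded le_rfl hω] at h
  obtain ⟨s, hsq, hs⟩ := h.exists_gt hq0 (conjExponent_ne_zero le_rfl) hω
  have hs0 : 0 < s := hq0.trans hsq
  have hs1 : 0 < 1 / s := by positivity
  have hsq' : 1 / s < 1 / q₀ := one_div_lt_one_div_of_lt hq0 hsq
  -- Take `q₁ = s`. Every `q` on the segment is then at most `s`, and the second exponent `∞`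
  -- dominates every conjugate exponent.
  refine ⟨1 / (1 / s + α), s, (one_lt_div (by linarith)).2 (by linarith),
    one_div_lt_one_div_of_lt hα0 (by linarith), hsq, by simp, ?_⟩
  rintro t ⟨ht0, ht1⟩ p q hp hq
  have ep : 1 / p = t + (1 - t) * (1 / s + α) := by rw [hp]; simp
  have eq' : 1 / q = t * (1 / q₀) + (1 - t) * (1 / s) := by rw [hq]; ring
  have hqs : 1 / s ≤ 1 / q := by rw [eq']; nlinarith
  have hq0' : 0 < q := one_div_pos.1 (hs1.trans_le hqs)
  have hp1 : 1 / p ≤ 1 := by rw [ep]; nlinarith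
  have hp0 : 0 < p := by
    rw [← one_div_pos, ep]
    rcases ht0.eq_or_lt with rfl | h0
    · linarith
    · nlinarith [mul_nonneg (sub_nonneg.2 ht1) (add_pos hs1 hα0).le]
  have hp1' : 1 ≤ p := by rwa [div_le_one hp0] at hp1
  rw [memApq_iff_pairBounded hp1' hω]
  exact hs.mono hω (ENNReal.ofReal_pos.2 hq0').ne'
    (ENNReal.ofReal_le_ofReal ((one_div_le_one_div hs0 hq0').1 hqs))
    (conjExponent_ne_zero hp1') (by simp [conjExponent])

open DiscreteMuckenhoupt in
theorem memApq_self_improve_right (α : ℝ) (hα0 : 0 < α) (hα1 : α < 1) (ω : ℤ → ℝ)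
    (hω : ∀ k, 0 < ω k) (p₀ : ℝ) (hp₀ : p₀ = 1 / α) (h : MemApq p₀ ⊤ ω) :
    ∃ p₂ q₂ : ℝ, 1 < p₂ ∧ p₂ < p₀ ∧ 1 < q₂ ∧ 1 / q₂ = 1 / p₂ - α ∧
      ∀ t ∈ Set.Icc (0 : ℝ) 1, ∀ (p : ℝ) (q : ENNReal),
        1 / p = t / p₀ + (1 - t) / p₂ → q⁻¹ = ENNReal.ofReal ((1 - t) / q₂) →
        MemApq p q ω := by
  have hp0 : 1 < p₀ := hp₀ ▸ (one_lt_div hα0).2 hα1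
  have hp0' : 0 < p₀ - 1 := by linarith
  have hω' : ∀ k, 0 < ω⁻¹ k := fun k => inv_pos.2 (hω k)
  rw [memApq_iff_pairBounded hp0.le hω, conjExponent_of_one_lt hp0] at h
  obtain ⟨s, hsp, hs⟩ := h.symm.exists_gt (by positivity) ENNReal.top_ne_zero hω'
  have hs := hs.symm
  rw [inv_inv] at hs
  have hs0 : 0 < s := lt_trans (by positivity) hsp
  have hs1 : 0 < 1 / s := by positivity
  have ep0 : 1 / p₀ = α := by rw [hp₀, one_div_one_div]
  have hsp' : 1 / s < 1 - α := by
    have := one_div_lt_one_div_of_lt (by positivity) hsp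
    rwa [one_div_div, show (p₀ - 1) / p₀ = 1 - 1 / p₀ by field_simp, ep0] at this
  -- Here `p₂` is conjugate to `s`, so conjugate exponents along the segment stay at most `s`, while
  -- the first exponent remains `∞`.
  refine ⟨1 / (1 - 1 / s), 1 / (1 - 1 / s - α), (one_lt_div (by linarith)).2 (by linarith),
    hp₀ ▸ one_div_lt_one_div_of_lt hα0 (by linarith),
    (one_lt_div (by linarith)).2 (by linarith), by simp, ?_⟩
  rintro t ⟨ht0, ht1⟩ p q hp hq
  have ep : 1 / p = t * α + (1 - t) * (1 - 1 / s) := by rw [hp, ← ep0]; field_simp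
  have hps : 1 / s ≤ 1 - 1 / p := by rw [ep]; nlinarith
  have hpα : α ≤ 1 / p := by rw [ep]; nlinarith
  have hp0 : 0 < p := one_div_pos.1 (hα0.trans_le hpα)
  have hp1 : 1 < p := by
    have : 1 / p < 1 := by linarith
    rwa [div_lt_one hp0] at this
  have hq0 : q ≠ 0 := by
    rintro rfl
    simp at hq
  rw [memApq_iff_pairBounded hp1.le hω]
  exact hs.mono hω hq0 le_top (conjExponent_ne_zero hp1.le) (conjExponent_le hp1 hs0 hps)


theorem proposition2p3 (α : ℝ) (hα0 : 0 < α) (hα1 : α < 1)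
    (ω : ℤ → ℝ) (hω : ∀ k, 0 < ω k) :
    -- interior exponents
    (∀ p q : ℝ, 1 < p → p < 1 / α → 1 / q = 1 / p - α →
      DiscreteMuckenhoupt.MemApq p (ENNReal.ofReal q) ω →
      ∃ p₁ p₂ q₁ q₂ : ℝ, 1 < p₁ ∧ p₁ < p ∧ p < p₂ ∧ p₂ < 1 / α ∧
        1 / q₁ = 1 / p₁ - α ∧ 1 / q₂ = 1 / p₂ - α ∧
        DiscreteMuckenhoupt.MemApq p₁ (ENNReal.ofReal q₁) ω ∧
        DiscreteMuckenhoupt.MemApq p₂ (ENNReal.ofReal q₂) ω) ∧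
    -- left endpoint `(1, q₀)`
    (∀ q₀ : ℝ, 1 / q₀ = 1 - α →
      DiscreteMuckenhoupt.MemApq 1 (ENNReal.ofReal q₀) ω →
      ∃ p₁ q₁ : ℝ, 1 < p₁ ∧ p₁ < 1 / α ∧ q₀ < q₁ ∧ 1 / q₁ = 1 / p₁ - α ∧
        ∀ t ∈ Set.Icc (0 : ℝ) 1, ∀ p q : ℝ,
          1 / p = t + (1 - t) / p₁ → 1 / q = t / q₀ + (1 - t) / q₁ →
          DiscreteMuckenhoupt.MemApq p (ENNReal.ofReal q) ω) ∧
    -- right endpoint `(1 / α, ∞)`; at `t = 1` the condition on `q` says `q = ∞`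
    (∀ p₀ : ℝ, p₀ = 1 / α →
      DiscreteMuckenhoupt.MemApq p₀ ⊤ ω →
      ∃ p₂ q₂ : ℝ, 1 < p₂ ∧ p₂ < p₀ ∧ 1 < q₂ ∧ 1 / q₂ = 1 / p₂ - α ∧
        ∀ t ∈ Set.Icc (0 : ℝ) 1, ∀ (p : ℝ) (q : ENNReal),
          1 / p = t / p₀ + (1 - t) / p₂ → q⁻¹ = ENNReal.ofReal ((1 - t) / q₂) →
          DiscreteMuckenhoupt.MemApq p q ω) := by
  exact ⟨fun p q hp hpα hq h => memApq_self_improve_interior α ω hω p q hp hpα hα0 hq h,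
    fun q₀ hq₀ h => memApq_self_improve_left α hα0 hα1 ω hω q₀ hq₀ h,
    fun p₀ hp₀ h => memApq_self_improve_right α hα0 hα1 ω hω p₀ hp₀ h⟩
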